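/- Let $(X,d)$ be an infinite uniformly locally finite metric space (for each $r>0$ the balls of radius $r$ have uniformly bounded finite cardinality), let $h\colon X\to\mathbb{R}$ be a coarse map (for each $r>0$ there is $s>0$ such that $d(x,y)<r$ implies $|h(x)-h(y)|<s$), and let $\beta\in\mathbb{R}$. Let $\mathrm{C}^*_u(X)\subseteq\mathcal{B}(\ell_2(X))$ be the uniform Roe algebra, i.e. the norm closure of the operators $a$ of finite propagation ($\sup\{d(x,y): \langle a\delta_y,\delta_x\rangle\neq 0\}<\infty$), with the flow $\sigma_{h,t}(a)=e^{it\bar h}ae^{-it\bar h}$, where $\bar h$ is the diagonal operator with entries $h(x)$. Let $\mathrm{Q}^*_u(X)=\mathrm{C}^*_u(X)/\mathcal{K}(\ell_2(X))$, with quotient map $\pi$ and induced flow $\sigma^\infty_{h,t}(\pi(a))=\pi(\sigma_{h,t}(a))$. Let $C(\nu X)=C_h(X)/c_0(X)\subseteq \mathrm{Q}^*_u(X)$ be the algebra of continuous functions on the Higson corona, i.e. the image under $\pi$ of the diagonal operators given by the Higson functions (the bounded $f\colon X\to\mathbb{C}$ such that for all $\varepsilon,R>0$ there is a finite $F\subseteq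 X$ with $|f(x)-f(y)|<\varepsilon$ for all $x,y\in X\setminus F$ with $d(x,y)<R$). For a flow $\sigma$ on a unital $\mathrm{C}^*$-algebra $A$, a state $\varphi$ of $A$ is a $(\sigma,\beta)$-KMS state if $\varphi(a\,\sigma_{i\beta}(b))=\varphi(ba)$ for all $a\in A$ and all $b\in A$ that are analytic for $\sigma$ (that is, $t\mapsto\sigma_t(b)$ extends to an entire map $z\mapsto\sigma_z(b)$ from $\mathbb{C}$ to $A$). A KMS state is extreme if it is an extreme point of the convex set of all $(\sigma,\beta)$-KMS states. Let $S$ be a set of $(\sigma_h^\infty,\beta)$-KMS states on $\mathrm{Q}^*_u(X)$ that is jointly faithful on $C(\nu X)$: if $c\in C(\nu X)$ and $\psi(c^*c)=0$ for all $\psi\in S$, then $c=0$. (For $S=\{\psi\}$ this says that the restriction of $\psi$ to $C(\nu X)$ is faithful.) Then there are exactly $2^{2^{\aleph_0}}$ extreme $(\sigma_h^\infty,\beta)$-KMS states on $\mathrm{Q}^*_u(X)$, and there are exactly $2^{2^{\aleph_0}}$ extreme $(\sigma_h,\beta)$-KMS states on $\mathrm{C}^*_u(X)$ which vanish on $\mathcal{K}(\ell_2(X))$.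 -/

import Mathlib

noncomputable section

namespace UniformRoe

open scoped ENNReal lp

/-! ### Coarse geometry -/

/-- For each `r > 0` the balls of radius `r` have uniformly bounded finite cardinality. -/
def UniformlyLocallyFinite (X : Type*) [MetricSpace X] : Prop :=
  ∀ r : ℝ, 0 < r → ∃ N : ℕ, ∀ x : X, (Metric.closedBall x r).encard ≤ N

/-- Coarse maps between metric spaces. -/
def IsCoarseMap {X Y : Type*} [MetricSpace X] [MetricSpace Y] (h : X → Y) : Prop :=
  ∀ r : ℝ, 0 < r → ∃ s : ℝ, 0 < s ∧ ∀ x y : X, dist x y < r → dist (h x) (h y) < s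

/-! ### KMS states

The notions of this section are stated for unital normed complex `*`-algebras, so that they apply
to a C⋆-algebra and to its quotient by a closed ideal alike. -/

section KMS

variable {A : Type*} [NormedRing A] [NormedAlgebra ℂ A] [StarRing A]

open scoped ComplexOrder in
/-- A state: a unital positive continuous linear functional. -/
structure IsState (φ : A →L[ℂ] ℂ) : Prop where
  map_one : φ 1 = 1
  nonneg : ∀ a : A, 0 ≤ φ (star a * a)

/-- `F` is an entire extension of the orbit map `t ↦ σ_t(b)`. An element `b` is analytic for `σ`
iff such an `F` exists; then `F` is unique, and `F z` is what is denoted `σ_z(b)`. -/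
structure IsEntireExtension (σ : ℝ → A →⋆ₐ[ℂ] A) (b : A) (F : ℂ → A) : Prop where
  entire : Differentiable ℂ F
  extends_orbit : ∀ t : ℝ, F t = σ t b

/-- The `(σ, β)`-KMS states: `φ(a σ_{iβ}(b)) = φ(b a)` for all `a` and all analytic `b`. -/
def kmsStates (σ : ℝ → A →⋆ₐ[ℂ] A) (β : ℝ) : Set (A →L[ℂ] ℂ) :=
  {φ | IsState φ ∧ ∀ (a b : A) (F : ℂ → A), IsEntireExtension σ b F →
    φ (a * F (Complex.I * β)) = φ (b * a)}

/-- A set `S` of functionals is (jointly) faithful on `C` if the only `c ∈ C` such that every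
`ψ ∈ S` vanishes at `c* c` is `c = 0`. For `S = {ψ}` with `ψ` a state this says that the
restriction of `ψ` to `C` is faithful. -/
def JointlyFaithfulOn [StarModule ℂ A] (S : Set (A →L[ℂ] ℂ)) (C : StarSubalgebra ℂ A) : Prop :=
  ∀ c ∈ C, (∀ ψ ∈ S, ψ (star c * c) = 0) → c = 0

end KMS

/-! ### Diagonal operators -/

section Diagonal

variable {X : Type*}

theorem memlp_diag (f : ℓ^∞(X, ℂ)) (ξ : ℓ²(X, ℂ)) : Memℓp (fun x => f x * ξ x) 2 := by
  have h2 : Memℓp (fun x => ‖f‖ • ξ x) 2 := (lp.memℓp ξ).const_smul ‖f‖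
  refine h2.mono' fun x => ?_
  rw [norm_mul, norm_smul, norm_norm]
  exact mul_le_mul_of_nonneg_right (lp.norm_apply_le_norm (by simp) f x) (norm_nonneg _)

/-- The diagonal operator on `ℓ²(X)` given by a bounded function, `(f ξ)(x) = f(x) ξ(x)`. -/
def diagOp (f : ℓ^∞(X, ℂ)) : ℓ²(X, ℂ) →L[ℂ] ℓ²(X, ℂ) :=
  LinearMap.mkContinuous
    { toFun := fun ξ => ⟨fun x => f x * ξ x, memlp_diag f ξ⟩
      map_add' := fun ξ η => by ext x; exact mul_add _ _ _
      map_smul' := fun c ξ => by ext x; exact mul_left_comm _ _ _ }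
    ‖f‖ fun ξ => by
      have : ‖(⟨fun x => f x * ξ x, memlp_diag f ξ⟩ : ℓ²(X, ℂ))‖ ≤ ‖(‖f‖ • ξ : ℓ²(X, ℂ))‖ := by
        refine lp.norm_mono (by simp) fun x => ?_
        change ‖f x * ξ x‖ ≤ ‖‖f‖ • ξ x‖
        rw [norm_mul, norm_smul, norm_norm]
        exact mul_le_mul_of_nonneg_right (lp.norm_apply_le_norm (by simp) f x) (norm_nonneg _)
      rwa [norm_smul, norm_norm] at this

@[simp] theorem diagOp_apply (f : ℓ^∞(X, ℂ)) (ξ : ℓ²(X, ℂ)) (x : X) :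
    diagOp f ξ x = f x * ξ x := rfl

/-- The identification of `ℓ^∞(X)` with the diagonal operators, as a `*`-homomorphism. -/
def diag : ℓ^∞(X, ℂ) →⋆ₐ[ℂ] (ℓ²(X, ℂ) →L[ℂ] ℓ²(X, ℂ)) where
  toFun := diagOp
  map_one' := by ext ξ x; simp
  map_mul' f g := by ext ξ x; simp [mul_assoc]
  map_zero' := by ext ξ x; simp
  map_add' f g := by ext ξ x; simp [add_mul]
  commutes' c := by
    ext ξ x
    rw [Algebra.algebraMap_eq_smul_one, Algebra.algebraMap_eq_smul_one]
    simp
  map_star' f := by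
    refine ContinuousLinearMap.ext fun ξ => ext_inner_left ℂ fun η => ?_
    rw [ContinuousLinearMap.star_eq_adjoint, ContinuousLinearMap.adjoint_inner_right,
      lp.inner_eq_tsum, lp.inner_eq_tsum]
    refine tsum_congr fun x => ?_
    simp
    ring

end Diagonal

/-! ### The uniform Roe algebra -/

section RoeAlgebra

variable {X : Type*}

open scoped Classical in
/-- The matrix entry `a_{x,y} = ⟨a δ_y, δ_x⟩`, that is, the value of `a δ_y` at `x`. -/
def entry (a : ℓ²(X, ℂ) →L[ℂ] ℓ²(X, ℂ)) (x y : X) : ℂ :=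
  a (lp.single 2 y 1) x

theorem entry_eq_inner [DecidableEq X] (a : ℓ²(X, ℂ) →L[ℂ] ℓ²(X, ℂ)) (x y : X) :
    entry a x y = inner ℂ (lp.single 2 x (1 : ℂ) : ℓ²(X, ℂ)) (a (lp.single 2 y 1)) := by
  rw [lp.inner_single_left]
  simp only [entry, RCLike.inner_apply, map_one, mul_one]
  rw [Subsingleton.elim (fun a b => Classical.propDecidable (a = b)) ‹DecidableEq X›]

theorem entry_star (a : ℓ²(X, ℂ) →L[ℂ] ℓ²(X, ℂ)) (x y : X) :
    entry (star a) x y = star (entry a y x) := by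
  classical
  rw [entry_eq_inner, entry_eq_inner, ContinuousLinearMap.star_eq_adjoint,
    ContinuousLinearMap.adjoint_inner_right]
  exact (inner_conj_symm _ _).symm

theorem entry_mul_ne_zero {a b : ℓ²(X, ℂ) →L[ℂ] ℓ²(X, ℂ)} {x y : X}
    (h : entry (a * b) x y ≠ 0) : ∃ z, entry a x z ≠ 0 ∧ entry b z y ≠ 0 := by
  classical
  by_contra! hz
  apply h
  have h1 : entry (a * b) x y = inner ℂ (star a (lp.single 2 x (1 : ℂ)) : ℓ²(X, ℂ))
      (b (lp.single 2 y 1)) := by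
    rw [entry_eq_inner, ContinuousLinearMap.star_eq_adjoint,
      ContinuousLinearMap.adjoint_inner_left]
    rfl
  rw [h1, lp.inner_eq_tsum]
  refine (tsum_congr fun z => ?_).trans tsum_zero
  have h2 : (star a (lp.single 2 x (1 : ℂ)) : ℓ²(X, ℂ)) z = star (entry a x z) := by
    rw [← entry_star]; simp only [entry]
  have h3 : (b (lp.single 2 y (1 : ℂ)) : ℓ²(X, ℂ)) z = entry b z y := by
    simp only [entry]
  rw [h2, h3]
  by_cases h4 : entry a x z = 0
  · simp [h4]
  · simp [hz z h4]

theorem entry_diag_of_ne (f : ℓ^∞(X, ℂ)) {x y : X} (h : x ≠ y) : entry (diag f) x y = 0 := by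
  classical
  change f x * _ = 0
  rw [lp.single_apply_ne 2 y _ h, mul_zero]

theorem isCompactOperator_star {a : ℓ²(X, ℂ) →L[ℂ] ℓ²(X, ℂ)} (ha : IsCompactOperator a) :
    IsCompactOperator (star a : ℓ²(X, ℂ) →L[ℂ] ℓ²(X, ℂ)) := by
  set b : ℓ²(X, ℂ) →L[ℂ] ℓ²(X, ℂ) := star a with hb
  have hc : IsCompactOperator (a * b : ℓ²(X, ℂ) →L[ℂ] ℓ²(X, ℂ)) := ha.comp_clm b
  have htb := (hc.isCompact_closure_image_ball (f := (a * b : ℓ²(X, ℂ) →L[ℂ] ℓ²(X, ℂ)).toLinearMap)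
    1).totallyBounded.subset subset_closure
  have hkey : ∀ ξ : ℓ²(X, ℂ), ‖b ξ‖ ^ 2 ≤ ‖(a * b) ξ‖ * ‖ξ‖ := by
    intro ξ
    have h1 : inner ℂ (b ξ) (b ξ) = inner ℂ ξ ((a * b) ξ) := by
      conv_lhs => rw [hb, ContinuousLinearMap.star_eq_adjoint,
        ContinuousLinearMap.adjoint_inner_left]
      rfl
    rw [← inner_self_eq_norm_sq (𝕜 := ℂ), h1, mul_comm]
    exact (RCLike.re_le_norm _).trans (norm_inner_le_norm _ _)
  have hb' : TotallyBounded (b '' Metric.ball 0 1) := by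
    rw [Metric.totallyBounded_iff]
    intro ε hε
    obtain ⟨t, hts, htf, hcov⟩ := Metric.finite_approx_of_totallyBounded htb (ε ^ 2 / 2)
      (by positivity)
    have hts' : ∀ y ∈ t, ∃ η ∈ Metric.ball (0 : ℓ²(X, ℂ)) 1, (a * b) η = y :=
      fun y hy => hts hy
    choose! g hg1 hg2 using hts'
    refine ⟨(b ∘ g) '' t, htf.image _, ?_⟩
    rintro _ ⟨ξ, hξ, rfl⟩
    obtain ⟨y, hy, hyξ⟩ := Set.mem_iUnion₂.1 (hcov ⟨ξ, hξ, rfl⟩)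
    refine Set.mem_iUnion₂.2 ⟨b (g y), ⟨y, hy, rfl⟩, ?_⟩
    have h2 : ‖(a * b) (ξ - g y)‖ < ε ^ 2 / 2 := by
      rw [map_sub, ← dist_eq_norm]
      have := hg2 y hy
      rw [← this] at hyξ
      exact hyξ
    have h3 : ‖ξ - g y‖ ≤ 2 := by
      have e1 := mem_ball_zero_iff.1 hξ
      have e2 := mem_ball_zero_iff.1 (hg1 y hy)
      linarith [norm_sub_le ξ (g y)]
    rw [Metric.mem_ball, dist_eq_norm, ← map_sub]
    refine lt_of_pow_lt_pow_left₀ 2 hε.le ((hkey _).trans_lt ?_)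
    nlinarith [norm_nonneg ((a * b) (ξ - g y)), norm_nonneg (ξ - g y)]
  exact ⟨closure (b '' Metric.ball 0 1), hb'.closure.isCompact_of_isClosed isClosed_closure,
    Filter.mem_of_superset (Metric.ball_mem_nhds 0 one_pos) fun ξ hξ =>
      subset_closure ⟨ξ, hξ, rfl⟩⟩

/-- The bounded function `x ↦ e^{i t h(x)}`. -/
def phase (h : X → ℝ) (t : ℝ) : ℓ^∞(X, ℂ) :=
  ⟨fun x => Complex.exp (Complex.I * (t * h x : ℝ)), memℓp_infty ⟨1, by
    rintro _ ⟨x, rfl⟩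
    simp [Complex.norm_exp]⟩⟩

theorem phase_apply (h : X → ℝ) (t : ℝ) (x : X) :
    phase h t x = Complex.exp (Complex.I * (t * h x : ℝ)) := rfl

theorem phase_neg_mul (h : X → ℝ) (t : ℝ) : phase h (-t) * phase h t = 1 := by
  ext x
  rw [lp.infty_coeFn_mul, Pi.mul_apply, phase_apply, phase_apply, ← Complex.exp_add]
  simp

theorem phase_mul_neg (h : X → ℝ) (t : ℝ) : phase h t * phase h (-t) = 1 := by
  rw [mul_comm, phase_neg_mul]

theorem star_phase (h : X → ℝ) (t : ℝ) : star (phase h t) = phase h (-t) := by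
  ext x
  change star (Complex.exp (Complex.I * (t * h x : ℝ))) = _
  rw [phase_apply, ← starRingEnd_apply, ← Complex.exp_conj]
  simp

variable [MetricSpace X]

/-- The propagation of `a` is at most `r`. -/
def HasPropagationLE (a : ℓ²(X, ℂ) →L[ℂ] ℓ²(X, ℂ)) (r : ℝ) : Prop :=
  ∀ x y : X, entry a x y ≠ 0 → dist x y ≤ r

theorem hasPropagationLE_diag (f : ℓ^∞(X, ℂ)) : HasPropagationLE (diag f) 0 := by
  intro x y h
  by_contra hxy
  exact h (entry_diag_of_ne f fun e => hxy (by simp [e]))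

variable (X)

/-- The algebraic uniform Roe algebra: all operators of finite propagation. -/
def algebraicRoeAlgebra : StarSubalgebra ℂ (ℓ²(X, ℂ) →L[ℂ] ℓ²(X, ℂ)) where
  carrier := {a | ∃ r : ℝ, HasPropagationLE a r}
  mul_mem' := by
    rintro a b ⟨r, hr⟩ ⟨s, hs⟩
    refine ⟨r + s, fun x y h => ?_⟩
    obtain ⟨z, h1, h2⟩ := entry_mul_ne_zero h
    exact (dist_triangle x z y).trans (add_le_add (hr _ _ h1) (hs _ _ h2))
  add_mem' := by
    rintro a b ⟨r, hr⟩ ⟨s, hs⟩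
    refine ⟨max r s, fun x y h => ?_⟩
    by_cases h1 : entry a x y = 0
    · refine le_max_of_le_right (hs x y fun h2 => h ?_)
      change entry a x y + entry b x y = 0
      rw [h1, h2, add_zero]
    · exact le_max_of_le_left (hr x y h1)
  algebraMap_mem' c := ⟨0, by
    rw [← AlgHomClass.commutes (diag (X := X)) c]
    exact hasPropagationLE_diag _⟩
  star_mem' := by
    rintro a ⟨r, hr⟩
    refine ⟨r, fun x y h => ?_⟩
    rw [entry_star] at h
    rw [dist_comm]
    exact hr y x fun h' => h (by simp [h'])

/-- The uniform Roe algebra `C*_u(X)`: the norm closure of the algebraic one. -/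
def uniformRoeAlgebra : StarSubalgebra ℂ (ℓ²(X, ℂ) →L[ℂ] ℓ²(X, ℂ)) :=
  (algebraicRoeAlgebra X).topologicalClosure

instance isClosed_uniformRoeAlgebra :
    IsClosed (uniformRoeAlgebra X : Set (ℓ²(X, ℂ) →L[ℂ] ℓ²(X, ℂ))) :=
  StarSubalgebra.isClosed_topologicalClosure _

/-- `C*_u(X)` as a C⋆-algebra. -/
def RoeAlgebra : Type _ := ↥(uniformRoeAlgebra X)

instance : CStarAlgebra (RoeAlgebra X) :=
  inferInstanceAs (CStarAlgebra ↥(uniformRoeAlgebra X))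

variable {X}

/-- The inclusion of `C*_u(X)` into the bounded operators on `ℓ²(X)`. -/
def toOp : RoeAlgebra X →⋆ₐ[ℂ] (ℓ²(X, ℂ) →L[ℂ] ℓ²(X, ℂ)) :=
  (uniformRoeAlgebra X).subtype

theorem continuous_toOp : Continuous (toOp : RoeAlgebra X → ℓ²(X, ℂ) →L[ℂ] ℓ²(X, ℂ)) :=
  continuous_subtype_val

theorem diag_mem (f : ℓ^∞(X, ℂ)) : diag f ∈ uniformRoeAlgebra X :=
  StarSubalgebra.le_topologicalClosure _ ⟨0, hasPropagationLE_diag f⟩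

/-- The inclusion of `ℓ^∞(X)` into `C*_u(X)` as diagonal operators. -/
def diagRoe : ℓ^∞(X, ℂ) →⋆ₐ[ℂ] RoeAlgebra X :=
  diag.codRestrict (uniformRoeAlgebra X) diag_mem

/-! ### The flow -/

/-- `σ_{h,t}(a) = e^{i t h} a e^{-i t h}` on `C*_u(X)`. -/
def roeFlow (h : X → ℝ) (t : ℝ) : RoeAlgebra X →⋆ₐ[ℂ] RoeAlgebra X where
  toFun a := diagRoe (phase h t) * a * diagRoe (phase h (-t))
  map_one' := by rw [mul_one, ← map_mul, phase_mul_neg, map_one]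
  map_mul' a b := by
    have : diagRoe (phase h (-t)) * diagRoe (phase h t) = (1 : RoeAlgebra X) := by
      rw [← map_mul, phase_neg_mul, map_one]
    calc _ = diagRoe (phase h t) * a * 1 * b * diagRoe (phase h (-t)) := by
          simp only [mul_one, mul_assoc]
      _ = _ := by rw [← this]; simp only [mul_assoc]
  map_zero' := by rw [mul_zero, zero_mul]
  map_add' a b := by rw [mul_add, add_mul]
  commutes' c := by
    rw [← Algebra.commutes, mul_assoc, ← map_mul, phase_mul_neg, map_one, mul_one]
  map_star' a := by
    rw [star_mul, star_mul, ← map_star, ← map_star, star_phase, star_phase, neg_neg, mul_assoc]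

/-! ### The uniform Roe corona -/

variable (X)

/-- The compact operators, as a two-sided ideal of `C*_u(X)`. -/
def compactIdeal : Ideal (RoeAlgebra X) where
  carrier := {a | IsCompactOperator (toOp a)}
  add_mem' {a b} ha hb := by
    rw [Set.mem_ofPred_eq, map_add]
    exact IsCompactOperator.add ha hb
  zero_mem' := by
    rw [Set.mem_ofPred_eq, map_zero]
    exact isCompactOperator_zero
  smul_mem' c a ha := by
    rw [Set.mem_ofPred_eq, smul_eq_mul, map_mul]
    exact IsCompactOperator.clm_comp ha (toOp c)

theorem mem_compactIdeal {X : Type*} [MetricSpace X] {a : RoeAlgebra X} :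
    a ∈ compactIdeal X ↔ IsCompactOperator (toOp a) := Iff.rfl

instance compactIdeal_isTwoSided : (compactIdeal X).IsTwoSided where
  mul_mem_of_left {a} b ha := by
    rw [mem_compactIdeal, map_mul]
    exact IsCompactOperator.comp_clm ha (toOp b)

instance isClosed_compactIdeal : IsClosed (compactIdeal X : Set (RoeAlgebra X)) :=
  isClosed_setOfPred_isCompactOperator.preimage continuous_toOp

/-- The uniform Roe corona `Q*_u(X) = C*_u(X) / K(ℓ²(X))`, with the quotient norm. -/
def RoeCorona : Type _ := RoeAlgebra X ⧸ compactIdeal X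

instance : Ring (RoeCorona X) := inferInstanceAs (Ring (RoeAlgebra X ⧸ compactIdeal X))

instance : Algebra ℂ (RoeCorona X) :=
  inferInstanceAs (Algebra ℂ (RoeAlgebra X ⧸ compactIdeal X))

instance : NormedAddCommGroup (RoeCorona X) :=
  inferInstanceAs (NormedAddCommGroup (RoeAlgebra X ⧸ compactIdeal X))

instance : NormedRing (RoeCorona X) where
  __ := (inferInstance : Ring (RoeCorona X))
  __ := (inferInstance : NormedAddCommGroup (RoeCorona X))
  dist_eq := dist_eq_norm_neg_add
  norm_mul_le x y := by
    refine le_of_forall_pos_le_add fun ε hε => ?_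
    have hcont : Filter.Tendsto (fun δ : ℝ => (‖x‖ + δ) * (‖y‖ + δ)) (nhdsWithin 0 (Set.Ioi 0))
        (nhds (‖x‖ * ‖y‖)) := by
      have : Continuous fun δ : ℝ => (‖x‖ + δ) * (‖y‖ + δ) := by fun_prop
      simpa using (this.tendsto 0).mono_left nhdsWithin_le_nhds
    obtain ⟨δ, hδ1, hδ⟩ := ((hcont.eventually (gt_mem_nhds (lt_add_of_pos_right _ hε))).and
      self_mem_nhdsWithin).exists
    obtain ⟨a, rfl, ha⟩ := Submodule.Quotient.norm_mk_lt (S := compactIdeal X) x hδ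
    obtain ⟨b, rfl, hb⟩ := Submodule.Quotient.norm_mk_lt (S := compactIdeal X) y hδ
    refine le_trans ?_ hδ1.le
    calc _ ≤ ‖a * b‖ := Submodule.Quotient.norm_mk_le (compactIdeal X) (a * b)
      _ ≤ ‖a‖ * ‖b‖ := norm_mul_le a b
      _ ≤ _ := mul_le_mul ha.le hb.le (norm_nonneg _) ((norm_nonneg _).trans ha.le)

instance : NormedAlgebra ℂ (RoeCorona X) where
  norm_smul_le :=
    (Submodule.Quotient.normedSpace (compactIdeal X) ℂ).norm_smul_le

/-- The involution of the corona, `π(a)* = π(a*)`. -/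
instance : StarRing (RoeCorona X) where
  star := Quotient.map (sa := (compactIdeal X).quotientRel) (sb := (compactIdeal X).quotientRel)
    star fun a b hab => by
      refine (Submodule.quotientRel_def (compactIdeal X)).2 ?_
      replace hab := (Submodule.quotientRel_def (compactIdeal X)).1 hab
      rw [← star_sub, mem_compactIdeal, map_star]
      exact isCompactOperator_star hab
  star_involutive := by
    rintro ⟨a⟩
    exact congrArg (Ideal.Quotient.mk (compactIdeal X)) (star_star a)
  star_mul := by
    rintro ⟨a⟩ ⟨b⟩
    exact congrArg (Ideal.Quotient.mk (compactIdeal X)) (star_mul a b)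
  star_add := by
    rintro ⟨a⟩ ⟨b⟩
    exact congrArg (Ideal.Quotient.mk (compactIdeal X)) (star_add a b)

instance : StarModule ℂ (RoeCorona X) where
  star_smul := by
    rintro c ⟨a⟩
    exact congrArg (Ideal.Quotient.mk (compactIdeal X)) (star_smul c a)

/-- The quotient map `π : C*_u(X) → Q*_u(X)`. -/
def toCorona : RoeAlgebra X →⋆ₐ[ℂ] RoeCorona X where
  __ := Ideal.Quotient.mkₐ ℂ (compactIdeal X)
  map_star' _ := rfl

variable {X}

theorem roeFlow_mem_compactIdeal (h : X → ℝ) (t : ℝ) {a : RoeAlgebra X}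
    (ha : a ∈ compactIdeal X) : roeFlow h t a ∈ compactIdeal X :=
  Ideal.mul_mem_right _ _ ((compactIdeal X).mul_mem_left _ ha)

/-- The flow `σ_h^∞` induced on the corona, `σ_{h,t}^∞(π(a)) = π(σ_{h,t}(a))`. -/
def coronaFlow (h : X → ℝ) (t : ℝ) : RoeCorona X →⋆ₐ[ℂ] RoeCorona X where
  __ := Ideal.Quotient.liftₐ (compactIdeal X)
    ((toCorona X).comp (roeFlow h t)).toAlgHom fun _ ha =>
      Ideal.Quotient.eq_zero_iff_mem.2 (roeFlow_mem_compactIdeal h t ha)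
  map_star' := by
    rintro ⟨a⟩
    exact map_star ((toCorona X).comp (roeFlow h t)) a

theorem coronaFlow_toCorona (h : X → ℝ) (t : ℝ) (a : RoeAlgebra X) :
    coronaFlow h t (toCorona X a) = toCorona X (roeFlow h t a) := rfl

/-! ### The Higson corona -/

/-- Higson functions (boundedness is part of the type of `f`). -/
def IsHigson (f : ℓ^∞(X, ℂ)) : Prop :=
  ∀ ε : ℝ, 0 < ε → ∀ R : ℝ, 0 < R → ∃ F : Finset X, ∀ x ∉ F, ∀ y ∉ F,
    dist x y < R → ‖f x - f y‖ < ε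

variable (X)

/-- The algebra `C_h(X)` of Higson functions. -/
def higsonAlgebra : StarSubalgebra ℂ (ℓ^∞(X, ℂ)) where
  carrier := {f | IsHigson f}
  mul_mem' := by
    classical
    intro f g hf hg ε hε R hR
    obtain ⟨F, hF⟩ := hf (ε / (2 * (‖g‖ + 1))) (by positivity) R hR
    obtain ⟨G, hG⟩ := hg (ε / (2 * (‖f‖ + 1))) (by positivity) R hR
    refine ⟨F ∪ G, fun x hx y hy hxy => ?_⟩
    rw [Finset.notMem_union] at hx hy
    have h1 := hF x hx.1 y hy.1 hxy
    have h2 := hG x hx.2 y hy.2 hxy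
    have e1 : ‖f x‖ ≤ ‖f‖ := lp.norm_apply_le_norm (by simp) f x
    have e2 : ‖g y‖ ≤ ‖g‖ := lp.norm_apply_le_norm (by simp) g y
    have n1 := norm_nonneg (f x)
    have n2 := norm_nonneg (g y)
    rw [lt_div_iff₀ (by positivity)] at h1 h2
    have : (f * g) x - (f * g) y = f x * (g x - g y) + (f x - f y) * g y := by
      rw [lp.infty_coeFn_mul, Pi.mul_apply, Pi.mul_apply]; ring
    rw [this]
    refine (norm_add_le _ _).trans_lt ?_
    rw [norm_mul, norm_mul]
    nlinarith [norm_nonneg (g x - g y), norm_nonneg (f x - f y)]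
  add_mem' := by
    classical
    intro f g hf hg ε hε R hR
    obtain ⟨F, hF⟩ := hf (ε / 2) (by positivity) R hR
    obtain ⟨G, hG⟩ := hg (ε / 2) (by positivity) R hR
    refine ⟨F ∪ G, fun x hx y hy hxy => ?_⟩
    rw [Finset.notMem_union] at hx hy
    have h1 := hF x hx.1 y hy.1 hxy
    have h2 := hG x hx.2 y hy.2 hxy
    have : (f + g) x - (f + g) y = (f x - f y) + (g x - g y) := by
      rw [lp.coeFn_add, Pi.add_apply, Pi.add_apply]; ring
    rw [this]
    exact (norm_add_le _ _).trans_lt (by linarith)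
  algebraMap_mem' c := by
    intro ε hε R hR
    refine ⟨∅, fun x _ y _ _ => ?_⟩
    rw [Algebra.algebraMap_eq_smul_one]
    simpa using hε
  star_mem' := by
    intro f hf ε hε R hR
    obtain ⟨F, hF⟩ := hf ε hε R hR
    refine ⟨F, fun x hx y hy hxy => ?_⟩
    have : (star f) x - (star f) y = star (f x - f y) := by
      rw [star_sub]; rfl
    rw [this, norm_star]
    exact hF x hx y hy hxy

/-- The algebra `C(νX) = C_h(X) / c_0(X)` of continuous functions on the Higson corona, as a
subalgebra of `Q*_u(X)`: the image of the Higson functions. -/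
def higsonCoronaAlgebra : StarSubalgebra ℂ (RoeCorona X) :=
  (higsonAlgebra X).map ((toCorona X).comp diagRoe)

end RoeAlgebra

end UniformRoe

end

/-! The lower bound comes from transporting an independent family of subsets of the integers into
the KMS simplex. Along a sparse sequence `x`, take disjoint balls of radius `n + 1` around `x n`.
Bumps on these balls have slopes tending to zero, so for every set `A` of indices the sum of the
bumps over `A` is a Higson function (`isHigson_bump`), and Higson functions are central in the
corona (`commutator_mem_compactIdeal`). If `A` is infinite, this function is nonzero in the corona,
so by joint faithfulness some state of `S` does not kill its square. Compressing that state by the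
central function gives a KMS state living on the balls indexed by `A` (`exists_kmsState_supported`).

Fix a choice of signs on the independent family. Finitely many signed sets always have an infinite
intersection, so compactness yields a KMS state living on the balls of all signed sets at once. Such
states form a weak-* closed face, hence an extreme KMS state is among them
(`exists_extreme_kmsState`). Two different choices disagree at some index, where the states live on
disjoint sets (`IsState.not_supported_compl`), so they are distinct. There are `2 ^ 2 ^ ℵ₀` choices.

On the Roe algebra the same argument runs with the compact operators added to the elements that the
face must annihilate. The upper bound is a count of all functionals: operators are matrices over a
countable set. -/

noncomputable section

namespace UniformRoe

open scoped ENNReal lp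

/-! ### States, KMS states, and extreme points of closed faces. -/

section States

variable {A : Type*} [NormedRing A] [NormedAlgebra ℂ A] [StarRing A]

theorem IsState.re_nonneg {φ : A →L[ℂ] ℂ} (hφ : IsState φ) (a : A) :
    0 ≤ (φ (star a * a)).re := (Complex.nonneg_iff.1 (hφ.nonneg a)).1

theorem IsState.im_eq_zero {φ : A →L[ℂ] ℂ} (hφ : IsState φ) (a : A) :
    (φ (star a * a)).im = 0 := (Complex.nonneg_iff.1 (hφ.nonneg a)).2.symm

/-- The Cauchy-Schwarz inequality for states, `|φ(a)|² ≤ φ(a* a)`. -/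
theorem IsState.norm_sq_le [StarModule ℂ A] {φ : A →L[ℂ] ℂ} (hφ : IsState φ) (a : A) :
    ‖φ a‖ ^ 2 ≤ (φ (star a * a)).re := by
  have key : ∀ z : ℂ, star (a - algebraMap ℂ A z) * (a - algebraMap ℂ A z) =
      star a * a - z • star a - (star z) • a + algebraMap ℂ A (star z * z) := by
    intro z
    simp only [Algebra.algebraMap_eq_smul_one, star_sub, star_smul, star_one, sub_mul, mul_sub,
      smul_mul_assoc, mul_smul_comm, one_mul, mul_one, smul_sub, smul_smul]
    rw [mul_comm z (star z)]
    abel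
  have hval : ∀ z : ℂ, φ (star (a - algebraMap ℂ A z) * (a - algebraMap ℂ A z)) =
      φ (star a * a) - z * φ (star a) - star z * φ a + star z * z := by
    intro z
    rw [key, map_add, map_sub, map_sub, map_smul, map_smul, Algebra.algebraMap_eq_smul_one,
      map_smul, hφ.map_one]
    simp
  -- `φ` is hermitian
  have h0 := hφ.im_eq_zero a
  have e1 := hφ.im_eq_zero (a - algebraMap ℂ A 1)
  have e2 := hφ.im_eq_zero (a - algebraMap ℂ A Complex.I)
  rw [hval] at e1 e2
  simp [h0] at e1 e2
  have hstar : φ (star a) = star (φ a) := by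
    apply Complex.ext
    · simp; linarith
    · simp; linarith
  -- With `z = φ a` the expansion collapses to `φ(a* a) - |φ(a)|²`.
  have e3 := hφ.re_nonneg (a - algebraMap ℂ A (φ a))
  rw [hval, hstar] at e3
  rw [← Complex.normSq_eq_norm_sq, Complex.normSq_apply]
  simp at e3
  linarith

theorem IsState.apply_eq_zero [StarModule ℂ A] {φ : A →L[ℂ] ℂ} (hφ : IsState φ) {a : A}
    (h : φ (star a * a) = 0) : φ a = 0 := by
  have := hφ.norm_sq_le a
  rw [h] at this
  have h2 : ‖φ a‖ ^ 2 = 0 := le_antisymm (by simpa using this) (by positivity)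
  simpa using h2

/-- In a C⋆-algebra `‖a‖² - a* a` has the form `b* b`; combine its positivity with Cauchy-Schwarz.
This bound places the states in the weak-* compact unit ball. -/
theorem IsState.norm_apply_le {A : Type*} [CStarAlgebra A] {φ : A →L[ℂ] ℂ} (hφ : IsState φ)
    (a : A) : ‖φ a‖ ≤ ‖a‖ := by
  let _ := CStarAlgebra.spectralOrder A
  have := CStarAlgebra.spectralOrderedRing A
  obtain ⟨b, hb⟩ := CStarAlgebra.nonneg_iff_eq_star_mul_self.1
    (sub_nonneg.2 (CStarAlgebra.star_mul_le_algebraMap_norm_sq (a := a)))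
  have h1 := hφ.re_nonneg b
  rw [← hb, map_sub, Algebra.algebraMap_eq_smul_one,
    ← Complex.coe_smul, map_smul, hφ.map_one] at h1
  simp only [Complex.sub_re, smul_eq_mul, mul_one, Complex.ofReal_re] at h1
  refine le_of_sq_le_sq ?_ (norm_nonneg a)
  linarith [hφ.norm_sq_le a]

/-- The weak-* topology is induced from a product of copies of `ℂ`. The real scalar structure is the
one in which extreme points are taken. -/
theorem locallyConvexSpace_weakDual (E : Type*) [NormedAddCommGroup E] [NormedSpace ℂ E] :
    LocallyConvexSpace ℝ (WeakDual ℂ E) :=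
  LocallyConvexSpace.induced (t := Pi.topologicalSpace)
    ({ toFun := fun φ a => φ a
       map_add' := fun _ _ => rfl
       map_smul' := fun _ _ => rfl } : WeakDual ℂ E →ₗ[ℝ] (E → ℂ))

/-- The KMS states vanishing at all `b* b`, `b ∈ B`, form a face. -/
theorem isExtreme_kmsStates (σ : ℝ → A →⋆ₐ[ℂ] A) (β : ℝ) (B : Set A) :
    IsExtreme ℝ (kmsStates σ β) {φ ∈ kmsStates σ β | ∀ b ∈ B, φ (star b * b) = 0} := by
  refine ⟨fun φ hφ => hφ.1, ?_⟩
  rintro φ hφ ψ hψ _ ⟨-, hχ⟩ ⟨s, t, hs, ht, -, rfl⟩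
  refine ⟨hφ, fun b hb => ?_⟩
  -- A combination of nonnegative numbers with positive weights vanishes only if each of them does.
  have h := congrArg Complex.re (hχ b hb)
  have h1 := hφ.1.re_nonneg b
  have h2 := hψ.1.re_nonneg b
  simp at h
  apply Complex.ext
  · have := mul_nonneg hs.le h1
    have := mul_nonneg ht.le h2
    have h3 : s * (φ (star b * b)).re = 0 := by linarith
    simpa [hs.ne'] using h3
  · simpa using hφ.1.im_eq_zero b

/-- For fixed `a`, `b` and `F`, each condition is a closed relation between values of `φ` at fixed
elements. -/
theorem isClosed_kmsStates (σ : ℝ → A →⋆ₐ[ℂ] A) (β : ℝ) :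
    IsClosed {φ : WeakDual ℂ A | WeakDual.toStrongDual φ ∈ kmsStates σ β} := by
  have hev := fun a : A => WeakDual.eval_continuous (𝕜 := ℂ) a
  have hset : {φ : WeakDual ℂ A | WeakDual.toStrongDual φ ∈ kmsStates σ β} =
      {φ : WeakDual ℂ A | φ 1 = 1} ∩ (⋂ a : A, {φ : WeakDual ℂ A | 0 ≤ (φ (star a * a)).re ∧
        (φ (star a * a)).im = 0}) ∩
      ⋂ (a : A) (b : A) (F : ℂ → A) (_ : IsEntireExtension σ b F),
        {φ : WeakDual ℂ A | φ (a * F (Complex.I * β)) = φ (b * a)} := by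
    ext φ
    simp only [Set.mem_ofPred_eq, Set.mem_inter_iff, Set.mem_iInter]
    constructor
    · rintro ⟨h1, h2⟩
      exact ⟨⟨h1.map_one, fun a => ⟨h1.re_nonneg a, h1.im_eq_zero a⟩⟩, h2⟩
    · rintro ⟨⟨h1, h2⟩, h3⟩
      exact ⟨⟨h1, fun a => Complex.nonneg_iff.2 ⟨(h2 a).1, (h2 a).2.symm⟩⟩, h3⟩
  rw [hset]
  refine (IsClosed.inter (isClosed_eq (hev 1) continuous_const) (isClosed_iInter fun a => ?_)).inter
    (isClosed_iInter fun a => isClosed_iInter fun b => isClosed_iInter fun F =>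
      isClosed_iInter fun _ => isClosed_eq (hev _) (hev _))
  exact (isClosed_le continuous_const (Complex.continuous_re.comp (hev _))).inter
    (isClosed_eq (Complex.continuous_im.comp (hev _)) continuous_const)

/-- If finitely many of the elements `b* b`, `b ∈ B`, are always annihilated by a common KMS state,
then all of them are annihilated by a common extreme KMS state. -/
theorem exists_extreme_kmsState (hbound : ∀ φ : A →L[ℂ] ℂ, IsState φ → ∀ a, ‖φ a‖ ≤ ‖a‖)
    (σ : ℝ → A →⋆ₐ[ℂ] A) (β : ℝ) (B : Set A)
    (hB : ∀ B₀ : Finset A, (B₀ : Set A) ⊆ B → ∃ φ ∈ kmsStates σ β, ∀ b ∈ B₀, φ (star b * b) = 0) :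
    ∃ φ ∈ (kmsStates σ β).extremePoints ℝ, ∀ b ∈ B, φ (star b * b) = 0 := by
  have := locallyConvexSpace_weakDual A
  set K : Set (WeakDual ℂ A) := {φ | WeakDual.toStrongDual φ ∈ kmsStates σ β} with hK
  have hKc : IsCompact K := by
    refine (WeakDual.isCompact_closedBall (𝕜 := ℂ) (0 : StrongDual ℂ A) 1).of_isClosed_subset
      (isClosed_kmsStates σ β) fun φ hφ => ?_
    rw [Set.mem_preimage, mem_closedBall_zero_iff]
    exact ContinuousLinearMap.opNorm_le_bound _ zero_le_one fun a => by
      simpa using hbound _ hφ.1 a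
  have hcl : ∀ b : B, IsClosed {φ : WeakDual ℂ A | φ (star b.1 * b.1) = 0} := fun b =>
    isClosed_eq (WeakDual.eval_continuous _) continuous_const
  have hne := hKc.inter_iInter_nonempty _ hcl fun u => by
    classical
    obtain ⟨φ, hφ, h0⟩ := hB (u.image Subtype.val) (by simp)
    refine ⟨StrongDual.toWeakDual φ, hφ, Set.mem_iInter₂.2 fun b hb => ?_⟩
    exact h0 b.1 (Finset.mem_image_of_mem _ hb)
  -- A nonempty compact set in a locally convex space has an extreme point (Krein-Milman); since the
  -- set is a face, this point is extreme among all KMS states.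
  obtain ⟨φ, hφ⟩ := (hKc.inter_right (isClosed_iInter hcl)).extremePoints_nonempty hne
  have hset : K ∩ ⋂ b : B, {φ : WeakDual ℂ A | φ (star b.1 * b.1) = 0} =
      {φ ∈ kmsStates σ β | ∀ b ∈ B, φ (star b * b) = 0} := by
    ext φ
    simp only [Set.mem_inter_iff, Set.mem_iInter, Subtype.forall]
    rfl
  rw [hset] at hφ
  exact ⟨φ, (isExtreme_kmsStates σ β B).extremePoints_subset_extremePoints hφ, hφ.1.2⟩

/-- If `σ` and `τ` are intertwined by `π`, then KMS states pull back along `π`. -/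
theorem comp_mem_kmsStates {A' : Type*} [NormedRing A'] [NormedAlgebra ℂ A'] [StarRing A']
    {σ : ℝ → A →⋆ₐ[ℂ] A} {τ : ℝ → A' →⋆ₐ[ℂ] A'} {β : ℝ} (π : A →⋆ₐ[ℂ] A') (π' : A →L[ℂ] A')
    (hπ : ∀ a, π' a = π a) (hστ : ∀ t a, τ t (π a) = π (σ t a)) {φ : A' →L[ℂ] ℂ}
    (hφ : φ ∈ kmsStates τ β) : φ.comp π' ∈ kmsStates σ β := by
  refine ⟨⟨by simp [hπ, hφ.1.map_one], fun a => ?_⟩, fun a b F hF => ?_⟩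
  · simpa [hπ, map_star] using hφ.1.nonneg (π a)
  · have := hφ.2 (π a) (π b) (fun z => π' (F z)) ⟨π'.differentiable.comp hF.entire, fun t => by
      rw [hF.extends_orbit, hπ, hστ]⟩
    simpa [hπ] using this

open scoped ComplexOrder in
/-- Compressing a KMS state by a selfadjoint central element gives a KMS state. -/
theorem compress_mem_kmsStates {σ : ℝ → A →⋆ₐ[ℂ] A} {β : ℝ} {ψ : A →L[ℂ] ℂ}
    (hψ : ψ ∈ kmsStates σ β) {g : A} (hg : star g = g) (hcomm : ∀ a, g * a = a * g)
    (h0 : ψ (g * g) ≠ 0) :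
    (ψ (g * g))⁻¹ • ψ.comp (ContinuousLinearMap.mul ℂ A (g * g)) ∈ kmsStates σ β := by
  refine ⟨⟨by simp [h0], fun a => ?_⟩, fun a b F hF => ?_⟩
  · have h1 : g * g * (star a * a) = star (a * g) * (a * g) := by
      rw [star_mul, hg, mul_assoc, mul_assoc, ← mul_assoc (star a), hcomm (star a * a)]
    have h2 := hψ.1.nonneg g
    rw [hg] at h2
    simp only [smul_apply, ContinuousLinearMap.comp_apply,
      ContinuousLinearMap.mul_apply', smul_eq_mul, h1]
    exact mul_nonneg (inv_nonneg.2 h2) (hψ.1.nonneg _)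
  -- The KMS identity for the pair `g² a`, `b`; centrality of `g` then moves `g²` to the left of
  -- `b`.
  · have := hψ.2 (g * g * a) b F hF
    have h1 : b * (g * g * a) = g * g * (b * a) := by
      rw [← mul_assoc b, ← mul_assoc b, ← hcomm b, mul_assoc g b g, ← hcomm b]
      simp only [mul_assoc]
    rw [h1, mul_assoc] at this
    simp [this]

end States

/-! ### Matrix entries, the Schur test, and compactness of commutators. -/

section Schur

variable {X : Type*}

/-- The value at `x` is the inner product of `a* δ_x` with `ξ`, a sum along row `x` of the matrix.
With `s = ∅` it shows that an operator with zero matrix is zero. -/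
theorem apply_eq_sum_entry (a : ℓ²(X, ℂ) →L[ℂ] ℓ²(X, ℂ)) (ξ : ℓ²(X, ℂ)) (x : X) (s : Finset X)
    (hs : ∀ y ∉ s, entry a x y = 0) : a ξ x = ∑ y ∈ s, entry a x y * ξ y := by
  classical
  have h1 : a ξ x = inner ℂ (star a (lp.single 2 x (1 : ℂ)) : ℓ²(X, ℂ)) ξ := by
    rw [ContinuousLinearMap.star_eq_adjoint, ContinuousLinearMap.adjoint_inner_left,
      lp.inner_single_left]
    simp
  have h2 : ∀ y, inner ℂ ((star a (lp.single 2 x (1 : ℂ)) : ℓ²(X, ℂ)) y) (ξ y) =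
      entry a x y * ξ y := by
    intro y
    have : (star a (lp.single 2 x (1 : ℂ)) : ℓ²(X, ℂ)) y = star (entry a x y) := by
      rw [← entry_star]; simp only [entry]
    rw [this]
    exact (RCLike.inner_apply _ _).trans (by simp [mul_comm])
  have h3 := lp.hasSum_inner (𝕜 := ℂ) (star a (lp.single 2 x (1 : ℂ)) : ℓ²(X, ℂ)) ξ
  rw [h1]
  rw [funext h2] at h3
  exact h3.unique (hasSum_sum_of_ne_finset_zero fun y hy => by rw [hs y hy, zero_mul])

theorem norm_entry_le (a : ℓ²(X, ℂ) →L[ℂ] ℓ²(X, ℂ)) (x y : X) : ‖entry a x y‖ ≤ ‖a‖ := by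
  classical
  refine (lp.norm_apply_le_norm (by simp) _ x).trans ((a.le_opNorm _).trans ?_)
  rw [lp.norm_single (by simp)]
  simp

theorem entry_diag_mul (f : ℓ^∞(X, ℂ)) (a : ℓ²(X, ℂ) →L[ℂ] ℓ²(X, ℂ)) (x y : X) :
    entry (diag f * a) x y = f x * entry a x y := rfl

theorem diag_single [DecidableEq X] (f : ℓ^∞(X, ℂ)) (y : X) :
    diag f (lp.single 2 y (1 : ℂ)) = f y • lp.single 2 y (1 : ℂ) := by
  ext x
  change f x * (lp.single 2 y (1 : ℂ) : ℓ²(X, ℂ)) x = f y * (lp.single 2 y (1 : ℂ) : ℓ²(X, ℂ)) x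
  by_cases hxy : x = y
  · rw [hxy]
  · rw [lp.single_apply_ne 2 y _ hxy, mul_zero, mul_zero]

theorem entry_mul_diag (f : ℓ^∞(X, ℂ)) (a : ℓ²(X, ℂ) →L[ℂ] ℓ²(X, ℂ)) (x y : X) :
    entry (a * diag f) x y = entry a x y * f y := by
  classical
  change a (diag f (lp.single 2 y 1)) x = _
  rw [diag_single, map_smul, mul_comm]
  rfl

/-- The indicator function of a set as an element of `ℓ^∞(X)`. -/
def indic (T : Set X) : ℓ^∞(X, ℂ) :=
  ⟨T.indicator 1, memℓp_infty ⟨1, by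
    rintro _ ⟨x, rfl⟩
    by_cases hx : x ∈ T <;> simp [hx]⟩⟩

theorem indic_apply (T : Set X) (x : X) : indic T x = T.indicator 1 x := rfl

theorem indic_apply_of_mem {T : Set X} {x : X} (h : x ∈ T) : indic T x = 1 := by
  simp [indic_apply, h]

theorem indic_apply_of_notMem {T : Set X} {x : X} (h : x ∉ T) : indic T x = 0 := by
  simp [indic_apply, h]

theorem isCompactOperator_diag_indic (G : Finset X) :
    IsCompactOperator (diag (indic (G : Set X)) : ℓ²(X, ℂ) →L[ℂ] ℓ²(X, ℂ)) := by
  classical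
  have h1 : ∀ x : X, IsCompactOperator (diag (indic {x}) : ℓ²(X, ℂ) →L[ℂ] ℓ²(X, ℂ)) := by
    intro x
    have e : (diag (indic {x}) : ℓ²(X, ℂ) →L[ℂ] ℓ²(X, ℂ)) =
        (ContinuousLinearMap.toSpanSingleton ℂ (lp.single 2 x (1 : ℂ) : ℓ²(X, ℂ))).comp
          (innerSL ℂ (lp.single 2 x (1 : ℂ) : ℓ²(X, ℂ))) := by
      ext ξ y
      change indic {x} y * ξ y = inner ℂ (lp.single 2 x (1 : ℂ) : ℓ²(X, ℂ)) ξ *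
        (lp.single 2 x (1 : ℂ) : ℓ²(X, ℂ)) y
      rw [lp.inner_single_left]
      by_cases hxy : y = x
      · subst hxy
        simp [indic_apply]
      · rw [lp.single_apply_ne 2 x _ hxy]
        simp [indic_apply, hxy]
    rw [e]
    exact (isCompactOperator_of_locallyCompactSpace_rng (ContinuousLinearMap.toSpanSingleton ℂ
      (lp.single 2 x (1 : ℂ) : ℓ²(X, ℂ)))).comp_clm _
  induction G using Finset.induction_on with
  | empty =>
    have : indic ((∅ : Finset X) : Set X) = 0 := by ext x; simp [indic_apply]
    rw [this, map_zero]
    exact isCompactOperator_zero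
  | insert x G hx ih =>
    have : indic ((insert x G : Finset X) : Set X) = indic {x} + indic (G : Set X) := by
      ext y
      rw [lp.coeFn_add, Pi.add_apply]
      by_cases hy : y = x
      · subst hy; simp [indic_apply, hx]
      · by_cases hyG : y ∈ G <;> simp [indic_apply, hy, hyG]
    rw [this, map_add]
    exact (h1 x).add ih

variable [MetricSpace X]

theorem UniformlyLocallyFinite.finite_closedBall (hX : UniformlyLocallyFinite X) (x : X) (r : ℝ) :
    (Metric.closedBall x r).Finite := by
  obtain ⟨N, hN⟩ := hX (max r 1) (by positivity)
  exact (Set.finite_of_encard_le_coe (hN x)).subset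
    (Metric.closedBall_subset_closedBall (le_max_left _ _))

/-- The Schur test for operators of finite propagation. -/
theorem opNorm_le_of_entry {N : ℕ} {R ε : ℝ} (hε : 0 ≤ ε)
    (hN : ∀ x : X, (Metric.closedBall x R).encard ≤ N) {a : ℓ²(X, ℂ) →L[ℂ] ℓ²(X, ℂ)}
    (hR : HasPropagationLE a R) (ha : ∀ x y, ‖entry a x y‖ ≤ ε) : ‖a‖ ≤ N * ε := by
  classical
  have hfin : ∀ x : X, (Metric.closedBall x R).Finite := fun x => Set.finite_of_encard_le_coe (hN x)
  set B : X → Finset X := fun x => (hfin x).toFinset with hB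
  have hcard : ∀ x, ((B x).card : ℝ) ≤ N := fun x => by
    have := hN x
    rw [(hfin x).encard_eq_coe_toFinset_card] at this
    exact_mod_cast this
  have hmem : ∀ x y, y ∈ B x ↔ dist y x ≤ R := fun x y => by simp [hB]
  refine ContinuousLinearMap.opNorm_le_bound _ (by positivity) fun ξ => ?_
  refine lp.norm_le_of_forall_sum_le (by simp) (by positivity) fun s => ?_
  simp only [ENNReal.toReal_ofNat, Real.rpow_ofNat]
  -- Cauchy-Schwarz on a row, which has at most `N` nonzero entries. The second factor `N` comes
  -- from exchanging the sums: each `y` lies in at most `N` of the balls `B x`.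
  have hx : ∀ x, ‖a ξ x‖ ^ 2 ≤ N * ε ^ 2 * ∑ y ∈ B x, ‖ξ y‖ ^ 2 := by
    intro x
    rw [apply_eq_sum_entry a ξ x (B x) fun y hy => by
      by_contra hne
      exact hy ((hmem x y).2 (dist_comm x y ▸ hR x y hne))]
    calc ‖∑ y ∈ B x, entry a x y * ξ y‖ ^ 2 ≤ (∑ y ∈ B x, ε * ‖ξ y‖) ^ 2 := by
          gcongr
          refine norm_sum_le_of_le _ fun y _ => ?_
          rw [norm_mul]
          exact mul_le_mul_of_nonneg_right (ha x y) (norm_nonneg _)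
      _ ≤ (B x).card * ∑ y ∈ B x, (ε * ‖ξ y‖) ^ 2 := sq_sum_le_card_mul_sum_sq
      _ ≤ N * ∑ y ∈ B x, (ε * ‖ξ y‖) ^ 2 := by
          gcongr
          exact_mod_cast hcard x
      _ = _ := by
          simp only [mul_pow]
          rw [mul_assoc, ← Finset.mul_sum]
  calc ∑ x ∈ s, ‖a ξ x‖ ^ 2 ≤ ∑ x ∈ s, N * ε ^ 2 * ∑ y ∈ B x, ‖ξ y‖ ^ 2 :=
        Finset.sum_le_sum fun x _ => hx x
    _ = N * ε ^ 2 * ∑ x ∈ s, ∑ y ∈ B x, ‖ξ y‖ ^ 2 := by rw [Finset.mul_sum]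
    _ = N * ε ^ 2 * ∑ y ∈ s.biUnion B, ∑ x ∈ s.filter (· ∈ B y), ‖ξ y‖ ^ 2 := by
        congr 1
        refine Finset.sum_comm' fun x y => ?_
        simp only [Finset.mem_filter, Finset.mem_biUnion, hmem, dist_comm x y]
        exact ⟨fun h => ⟨h, x, h⟩, fun h => h.1⟩
    _ ≤ N * ε ^ 2 * ∑ y ∈ s.biUnion B, N * ‖ξ y‖ ^ 2 := by
        gcongr with y
        rw [Finset.sum_const, nsmul_eq_mul]
        gcongr
        refine le_trans ?_ (Nat.cast_le.1 (hcard y))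
        exact Finset.card_le_card fun x hx => (Finset.mem_filter.1 hx).2
    _ = (N * ε) ^ 2 * ∑ y ∈ s.biUnion B, ‖ξ y‖ ^ 2 := by rw [← Finset.mul_sum]; ring
    _ ≤ (N * ε) ^ 2 * ‖ξ‖ ^ 2 := by
        gcongr
        have := lp.sum_rpow_le_norm_rpow (p := 2) (by simp) ξ (s.biUnion B)
        simpa using this
    _ = _ := by ring

/-- The commutator has entries `(f x - f y) a_{x,y}`, with `x` and `y` at bounded distance. Outside
finitely many rows they are uniformly small, so by the Schur test the commutator is a norm limit of
its finite-row truncations. -/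
theorem isCompactOperator_commutator_of_hasPropagationLE (hX : UniformlyLocallyFinite X)
    {f : ℓ^∞(X, ℂ)} (hf : IsHigson f) {a : ℓ²(X, ℂ) →L[ℂ] ℓ²(X, ℂ)} {r : ℝ}
    (ha : HasPropagationLE a r) :
    IsCompactOperator (diag f * a - a * diag f : ℓ²(X, ℂ) →L[ℂ] ℓ²(X, ℂ)) := by
  classical
  set T : ℓ²(X, ℂ) →L[ℂ] ℓ²(X, ℂ) := diag f * a - a * diag f
  have hTe : ∀ x y, entry T x y = (f x - f y) * entry a x y := fun x y => by
    change entry (diag f * a) x y - entry (a * diag f) x y = _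
    rw [entry_diag_mul, entry_mul_diag]
    ring
  set R := max r 1
  have hR : 0 < R := by positivity
  obtain ⟨N, hN⟩ := hX R hR
  have hcl := isClosed_setOfPred_isCompactOperator (𝕜₁ := ℂ) (𝕜₂ := ℂ) (σ₁₂ := RingHom.id ℂ)
    (M₁ := ℓ²(X, ℂ)) (M₂ := ℓ²(X, ℂ))
  refine hcl.closure_subset (Metric.mem_closure_iff.2 fun ε hε => ?_)
  -- Chosen so that the Schur bound `N * (δ * ‖a‖)` is below `ε`; the summands `1` keep the quotient
  -- meaningful when `N` or `‖a‖` is zero.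
  set δ := ε / ((N + 1) * (‖a‖ + 1)) with hδ
  have hδ0 : 0 < δ := by positivity
  obtain ⟨F, hF⟩ := hf δ hδ0 (R + 1) (by positivity)
  -- Thickening `F` by `R` ensures that a nonzero entry in a row outside `G` has both indices
  -- outside `F`.
  have hGfin : (⋃ z ∈ F, Metric.closedBall z R).Finite :=
    F.finite_toSet.biUnion fun z _ => hX.finite_closedBall z R
  set G := hGfin.toFinset with hG
  refine ⟨diag (indic (G : Set X)) * T, (isCompactOperator_diag_indic G).comp_clm T, ?_⟩
  have hent : ∀ x y, entry (T - diag (indic (G : Set X)) * T) x y =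
      (1 - indic (G : Set X) x) * entry T x y := fun x y => by
    change entry T x y - entry (diag (indic (G : Set X)) * T) x y = _
    rw [entry_diag_mul]
    ring
  rw [dist_eq_norm]
  have hbd : ‖T - diag (indic (G : Set X)) * T‖ ≤ N * (δ * ‖a‖) := by
    refine opNorm_le_of_entry (by positivity) hN (fun x y hxy => ?_) fun x y => ?_
    · rw [hent, hTe] at hxy
      exact (ha x y (right_ne_zero_of_mul (right_ne_zero_of_mul hxy))).trans (le_max_left _ _)
    · rw [hent]
      by_cases hx : x ∈ G
      · rw [indic_apply_of_mem (by exact_mod_cast hx)]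
        simp
        positivity
      · rw [indic_apply_of_notMem (by exact_mod_cast hx), sub_zero, one_mul, hTe, norm_mul]
        by_cases hxy : entry a x y = 0
        · rw [hxy]
          simp
          positivity
        · have hd : dist x y ≤ R := (ha x y hxy).trans (le_max_left _ _)
          simp only [hG, Set.Finite.mem_toFinset, Set.mem_iUnion, not_exists,
            Metric.mem_closedBall, not_le] at hx
          refine mul_le_mul (hF x (fun h => ?_) y (fun h => ?_) (by linarith)).le
            (norm_entry_le a x y) (norm_nonneg _) hδ0.le
          · have := hx x h
            rw [dist_self] at this
            linarith
          · linarith [hx y h]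
  refine hbd.trans_lt ?_
  have e : N * (δ * ‖a‖) < (N + 1) * (δ * (‖a‖ + 1)) := by
    have : 0 ≤ (N : ℝ) := N.cast_nonneg
    nlinarith [norm_nonneg a, mul_nonneg hδ0.le (norm_nonneg a), mul_nonneg this hδ0.le]
  refine e.trans_eq ?_
  rw [hδ]
  field_simp

/-- Higson functions commute with the uniform Roe algebra modulo the compact operators. -/
theorem commutator_mem_compactIdeal (hX : UniformlyLocallyFinite X)
    {f : ℓ^∞(X, ℂ)} (hf : IsHigson f) (a : RoeAlgebra X) :
    diagRoe f * a - a * diagRoe f ∈ compactIdeal X := by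
  have hcl := isClosed_setOfPred_isCompactOperator (𝕜₁ := ℂ) (𝕜₂ := ℂ) (σ₁₂ := RingHom.id ℂ)
    (M₁ := ℓ²(X, ℂ)) (M₂ := ℓ²(X, ℂ))
  have hcont : Continuous fun b : ℓ²(X, ℂ) →L[ℂ] ℓ²(X, ℂ) => diag f * b - b * diag f := by fun_prop
  have hmem : toOp a ∈ closure (algebraicRoeAlgebra X : Set (ℓ²(X, ℂ) →L[ℂ] ℓ²(X, ℂ))) := a.2
  rw [mem_compactIdeal, map_sub, map_mul, map_mul]
  refine closure_minimal (fun b hb => ?_) (hcl.preimage hcont) hmem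
  obtain ⟨r, hr⟩ := hb
  exact isCompactOperator_commutator_of_hasPropagationLE hX hf hr

end Schur

/-! ### Sparse bumps on the space, and states supported near them. -/

section Bump

variable {X : Type*} [MetricSpace X]

/-- In a locally finite infinite metric space there are points whose mutual distances grow. -/
theorem exists_sparse_seq [Infinite X] (hX : UniformlyLocallyFinite X) :
    ∃ x : ℕ → X, ∀ m n : ℕ, m < n → 2 * ((n : ℝ) + 1) < dist (x m) (x n) := by
  -- The recursion sees only the finite set of earlier choices, so each point carries a label.
  -- Labels strictly increase, hence the label at position `n` is at least `n`.
  obtain ⟨f, -, hf⟩ := exists_seq_of_forall_finset_exists (fun _ : ℕ × X => True)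
    (fun p q => p.1 < q.1 ∧ 2 * ((q.1 : ℝ) + 1) < dist p.2 q.2) fun s _ => by
      set l := s.sup Prod.fst + 1 with hl
      have hfin : (⋃ p ∈ s, Metric.closedBall p.2 (2 * ((l : ℝ) + 1))).Finite :=
        s.finite_toSet.biUnion fun p _ => hX.finite_closedBall _ _
      obtain ⟨y, hy⟩ := hfin.exists_notMem
      refine ⟨(l, y), trivial, fun p hp => ⟨Nat.lt_succ_of_le (Finset.le_sup hp), ?_⟩⟩
      simp only [Set.mem_iUnion, not_exists, Metric.mem_closedBall, not_le] at hy
      rw [dist_comm]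
      exact hy p hp
  have hmono : StrictMono fun n => (f n).1 := fun m n hmn => (hf m n hmn).1
  refine ⟨fun n => (f n).2, fun m n hmn => lt_of_le_of_lt ?_ (hf m n hmn).2⟩
  have : (n : ℝ) ≤ (f n).1 := by exact_mod_cast hmono.id_le n
  linarith

/-- The union of the balls `B(x_n, n + 1)` with `n ∈ A`. -/
def ballUnion (x : ℕ → X) (A : Set ℕ) : Set X := ⋃ n ∈ A, Metric.ball (x n) (n + 1)

theorem ballUnion_mono (x : ℕ → X) {A B : Set ℕ} (h : A ⊆ B) : ballUnion x A ⊆ ballUnion x B :=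
  Set.biUnion_subset_biUnion_left h

/-- For `m < n` the radii satisfy `(m + 1) + (n + 1) < 2 * (n + 1)`, which is less than the distance
of the centres. -/
theorem disjoint_ballUnion {x : ℕ → X}
    (hx : ∀ m n : ℕ, m < n → 2 * ((n : ℝ) + 1) < dist (x m) (x n)) {A B : Set ℕ}
    (h : Disjoint A B) : Disjoint (ballUnion x A) (ballUnion x B) := by
  have key : ∀ m n : ℕ, m < n → ∀ y, dist y (x m) < m + 1 → dist y (x n) < n + 1 → False := by
    intro m n hmn y h1 h2
    have h3 := hx m n hmn
    have h4 := dist_triangle_left (x m) (x n) y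
    have h5 : (m : ℝ) < n := by exact_mod_cast hmn
    linarith
  rw [Set.disjoint_left]
  intro y hA hB
  simp only [ballUnion, Set.mem_iUnion, Metric.mem_ball, exists_prop] at hA hB
  obtain ⟨m, hm, hym⟩ := hA
  obtain ⟨n, hn, hyn⟩ := hB
  rcases lt_trichotomy m n with hlt | rfl | hlt
  · exact key m n hlt y hym hyn
  · exact Set.disjoint_left.1 h hm hn
  · exact key n m hlt y hyn hym

open scoped Classical in
/-- The function with a bump of height one and radius `n + 1` at each `x_n` with `n ∈ A`. -/
def bumpReal (x : ℕ → X) (A : Set ℕ) (y : X) : ℝ :=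
  ⨆ n : ℕ, if n ∈ A then max 0 (1 - dist y (x n) / (n + 1)) else 0

open scoped Classical in
theorem bumpReal_term_mem (x : ℕ → X) (A : Set ℕ) (y : X) (n : ℕ) :
    (if n ∈ A then max 0 (1 - dist y (x n) / (n + 1)) else 0) ∈ Set.Icc (0 : ℝ) 1 := by
  have : 0 ≤ dist y (x n) / ((n : ℝ) + 1) := by positivity
  split_ifs
  · exact ⟨le_max_left _ _, max_le zero_le_one (by linarith)⟩
  · exact ⟨le_rfl, zero_le_one⟩

open scoped Classical in
theorem le_bumpReal (x : ℕ → X) (A : Set ℕ) (y : X) (n : ℕ) :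
    (if n ∈ A then max 0 (1 - dist y (x n) / (n + 1)) else 0) ≤ bumpReal x A y :=
  le_ciSup (f := fun n : ℕ => if n ∈ A then max 0 (1 - dist y (x n) / ((n : ℝ) + 1)) else 0)
    ⟨1, by rintro _ ⟨n, rfl⟩; exact (bumpReal_term_mem x A y n).2⟩ n

theorem bumpReal_nonneg (x : ℕ → X) (A : Set ℕ) (y : X) : 0 ≤ bumpReal x A y :=
  (bumpReal_term_mem x A y 0).1.trans (le_bumpReal x A y 0)

theorem bumpReal_le_one (x : ℕ → X) (A : Set ℕ) (y : X) : bumpReal x A y ≤ 1 :=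
  ciSup_le fun n => (bumpReal_term_mem x A y n).2

theorem bumpReal_apply_of_mem (x : ℕ → X) {A : Set ℕ} {n : ℕ} (hn : n ∈ A) :
    bumpReal x A (x n) = 1 :=
  le_antisymm (bumpReal_le_one x A _) (by simpa [hn] using le_bumpReal x A (x n) n)

theorem bumpReal_eq_zero (x : ℕ → X) {A : Set ℕ} {y : X} (hy : y ∉ ballUnion x A) :
    bumpReal x A y = 0 := by
  refine le_antisymm (ciSup_le fun n => ?_) (bumpReal_nonneg x A y)
  split_ifs with hn
  · refine max_le le_rfl ?_
    simp only [ballUnion, Set.mem_iUnion, Metric.mem_ball, not_exists, not_lt] at hy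
    rw [sub_nonpos, le_div_iff₀ (by positivity), one_mul]
    exact hy n hn
  · exact le_rfl

/-- `bumpReal` as an element of `ℓ^∞(X)`. -/
def bump (x : ℕ → X) (A : Set ℕ) : ℓ^∞(X, ℂ) :=
  ⟨fun y => (bumpReal x A y : ℂ), memℓp_infty ⟨1, by
    rintro _ ⟨y, rfl⟩
    beta_reduce
    rw [Complex.norm_real, Real.norm_of_nonneg (bumpReal_nonneg x A y)]
    exact bumpReal_le_one x A y⟩⟩

theorem bump_apply (x : ℕ → X) (A : Set ℕ) (y : X) : bump x A y = (bumpReal x A y : ℂ) := rfl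

theorem star_bump (x : ℕ → X) (A : Set ℕ) : star (bump x A) = bump x A := by
  ext y
  exact Complex.conj_ofReal _

/-- The bump at `x n` is Lipschitz with constant `1 / (n + 1)`. Those with `n < N` vanish off a
finite set, and each of the others varies by at most `R / (N + 1)` over distances below `R`; a
supremum of such functions varies no more. -/
theorem isHigson_bump (hX : UniformlyLocallyFinite X) (x : ℕ → X) (A : Set ℕ) :
    IsHigson (bump x A) := by
  intro ε hε R hR
  obtain ⟨N, hN⟩ := exists_nat_gt (R / ε)
  have hN' : R / (N + 1) < ε := by
    rw [div_lt_iff₀ hε] at hN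
    rw [div_lt_iff₀ (by positivity)]
    nlinarith
  have hfin : (⋃ n ∈ Finset.range N, Metric.closedBall (x n) ((n : ℝ) + 1)).Finite :=
    (Finset.range N).finite_toSet.biUnion fun n _ => hX.finite_closedBall _ _
  have key : ∀ y ∉ hfin.toFinset, ∀ z, dist y z < R →
      bumpReal x A y ≤ bumpReal x A z + R / (N + 1) := by
    intro y hy z hyz
    have hpos : 0 ≤ bumpReal x A z + R / (N + 1) :=
      add_nonneg (bumpReal_nonneg x A z) (by positivity)
    refine ciSup_le fun n => ?_
    split_ifs with hn
    · refine max_le hpos ?_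
      have hn1 : (0 : ℝ) < n + 1 := by positivity
      by_cases hnN : n < N
      · simp only [Set.Finite.mem_toFinset, Set.mem_iUnion, not_exists, Finset.mem_range,
          Metric.mem_closedBall, not_le] at hy
        have h1 := hy n hnN
        have h2 : 1 ≤ dist y (x n) / ((n : ℝ) + 1) := by
          rw [le_div_iff₀ hn1]
          linarith
        linarith
      · have h1 := le_bumpReal x A z n
        rw [if_pos hn] at h1
        have h2 := (le_max_right _ _).trans h1
        have h3 : dist z (x n) / ((n : ℝ) + 1) ≤ dist y (x n) / (n + 1) + R / (n + 1) := by
          rw [← add_div]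
          gcongr
          linarith [dist_triangle_left z (x n) y]
        have h4 : R / ((n : ℝ) + 1) ≤ R / (N + 1) := by
          gcongr
          exact not_lt.1 hnN
        linarith
    · exact hpos
  refine ⟨hfin.toFinset, fun y hy z hz hyz => ?_⟩
  rw [bump_apply, bump_apply, ← Complex.ofReal_sub, Complex.norm_real, Real.norm_eq_abs]
  refine lt_of_le_of_lt (abs_le.2 ⟨?_, ?_⟩) hN'
  · linarith [key z hz y (by rwa [dist_comm])]
  · linarith [key y hy z hyz]

/-- A diagonal operator which is `1` at infinitely many points is not compact. -/
theorem not_isCompactOperator_diag {X : Type*} {f : ℓ^∞(X, ℂ)} {x : ℕ → X}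
    (hx : Function.Injective x) (hf : ∀ n, f (x n) = 1) :
    ¬ IsCompactOperator (diag f : ℓ²(X, ℂ) →L[ℂ] ℓ²(X, ℂ)) := by
  classical
  intro hc
  obtain ⟨K, hK, hsub⟩ := IsCompactOperator.image_closedBall_subset_compact
    (f := (diag f : ℓ²(X, ℂ) →L[ℂ] ℓ²(X, ℂ)).toLinearMap) hc 1
  set v : ℕ → ℓ²(X, ℂ) := fun n => lp.single 2 (x n) (1 : ℂ) with hv
  have hvK : ∀ n, v n ∈ K := fun n => hsub ⟨v n, by
    rw [mem_closedBall_zero_iff, hv, lp.norm_single (by simp)]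
    simp, by
    change diag f (v n) = v n
    rw [hv, diag_single, hf, one_smul]⟩
  -- The basis vectors at the points `x n` are fixed by the operator and lie at mutual distance at
  -- least one, so no subsequence is Cauchy.
  obtain ⟨w, -, φ, hφ, hlim⟩ := hK.tendsto_subseq hvK
  obtain ⟨N, hN⟩ := Metric.cauchySeq_iff.1 hlim.cauchySeq 1 one_pos
  have h1 := hN N le_rfl (N + 1) (Nat.le_succ N)
  have hne : x (φ N) ≠ x (φ (N + 1)) := fun h => (hφ (Nat.lt_succ_self N)).ne (hx h)
  have h2 := lp.norm_apply_le_norm (by simp) (v (φ N) - v (φ (N + 1))) (x (φ N))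
  rw [← dist_eq_norm] at h2
  have h3 : (v (φ N) - v (φ (N + 1)) : ℓ²(X, ℂ)) (x (φ N)) = 1 := by
    rw [lp.coeFn_sub, Pi.sub_apply]
    simp only [hv]
    rw [lp.single_apply_self, lp.single_apply_ne 2 _ _ hne, sub_zero]
  rw [h3, norm_one] at h2
  exact absurd h1 (not_lt.2 h2)

theorem toCorona_eq_zero_iff {a : RoeAlgebra X} :
    toCorona X a = 0 ↔ IsCompactOperator (toOp a) :=
  Ideal.Quotient.eq_zero_iff_mem (I := compactIdeal X)

theorem toCorona_surjective : Function.Surjective (toCorona X) :=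
  Ideal.Quotient.mk_surjective (I := compactIdeal X)

/-- The inclusion of `ℓ^∞(X)` into the corona. -/
def diagCorona : ℓ^∞(X, ℂ) →⋆ₐ[ℂ] RoeCorona X := (toCorona X).comp diagRoe

/-- Higson functions are central in the corona. -/
theorem diagCorona_comm (hX : UniformlyLocallyFinite X) {f : ℓ^∞(X, ℂ)} (hf : IsHigson f)
    (q : RoeCorona X) : diagCorona f * q = q * diagCorona f := by
  obtain ⟨a, rfl⟩ := toCorona_surjective q
  change toCorona X (diagRoe f) * _ = _ * toCorona X (diagRoe f)
  rw [← map_mul, ← map_mul, ← sub_eq_zero, ← map_sub, toCorona_eq_zero_iff]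
  exact commutator_mem_compactIdeal hX hf a

/-- The projection onto the complement of `ballUnion x A`. -/
def awayFrom (x : ℕ → X) (A : Set ℕ) : ℓ^∞(X, ℂ) := indic (ballUnion x A)ᶜ

theorem bump_mul_awayFrom (x : ℕ → X) {A B : Set ℕ} (h : A ⊆ B) :
    bump x A * awayFrom x B = 0 := by
  ext y
  rw [lp.infty_coeFn_mul, Pi.mul_apply, bump_apply, lp.coeFn_zero, Pi.zero_apply]
  by_cases hy : y ∈ ballUnion x A
  · rw [awayFrom, indic_apply_of_notMem (by simpa using ballUnion_mono x h hy), mul_zero]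
  · rw [bumpReal_eq_zero x hy, Complex.ofReal_zero, zero_mul]

/-- The state is `ψ(g² ·)` normalised, with `g` the image of the bump function of `A` and `ψ` in `S`
not vanishing at `g²`. It kills the complement of the balls over any `B ⊇ A` because `g` is
supported on the balls over `A`. -/
theorem exists_kmsState_supported (hX : UniformlyLocallyFinite X) {h : X → ℝ} {β : ℝ}
    {S : Set (RoeCorona X →L[ℂ] ℂ)} (hS : S ⊆ kmsStates (coronaFlow h) β)
    (hfaithful : JointlyFaithfulOn S (higsonCoronaAlgebra X)) {x : ℕ → X}
    (hx : Function.Injective x) {A : Set ℕ} (hA : A.Infinite) :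
    ∃ φ ∈ kmsStates (coronaFlow h) β, ∀ B, A ⊆ B →
      φ (star (diagCorona (awayFrom x B)) * diagCorona (awayFrom x B)) = 0 := by
  set g := diagCorona (bump x A) with hg
  have hgs : star g = g := by rw [hg, ← map_star, star_bump]
  have hg0 : g ≠ 0 := fun h0 => by
    refine not_isCompactOperator_diag (f := bump x A) (x := x ∘ Nat.nth (· ∈ A))
      (hx.comp (Nat.nth_injective hA)) (fun n => ?_) (toCorona_eq_zero_iff.1 h0)
    exact congrArg Complex.ofReal (bumpReal_apply_of_mem x (Nat.nth_mem_of_infinite hA n))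
  obtain ⟨ψ, hψ, hψg⟩ : ∃ ψ ∈ S, ψ (g * g) ≠ 0 := by
    by_contra! hcon
    refine hg0 (hfaithful g ⟨bump x A, isHigson_bump hX x A, rfl⟩ fun ψ hψ => ?_)
    rw [hgs]
    exact hcon ψ hψ
  refine ⟨_, compress_mem_kmsStates (hS hψ) hgs (diagCorona_comm hX (isHigson_bump hX x A)) hψg,
    fun B hAB => ?_⟩
  have h1 : g * g * (star (diagCorona (awayFrom x B)) * diagCorona (awayFrom x B)) = 0 := by
    rw [hg, ← map_star, ← map_mul, ← map_mul, ← map_mul,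
      mul_comm (star _), mul_assoc, ← mul_assoc (bump x A) (awayFrom x B),
      bump_mul_awayFrom x hAB, zero_mul, mul_zero, map_zero]
  simp [h1]

/-- No state is supported both near the points indexed by `A` and near those indexed by `Aᶜ`. -/
theorem IsState.not_supported_compl {x : ℕ → X}
    (hx : ∀ m n : ℕ, m < n → 2 * ((n : ℝ) + 1) < dist (x m) (x n)) {A' : Type*} [NormedRing A']
    [NormedAlgebra ℂ A'] [StarRing A'] {φ : A' →L[ℂ] ℂ} (hφ : IsState φ)
    (ρ : ℓ^∞(X, ℂ) →⋆ₐ[ℂ] A') {A : Set ℕ}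
    (h1 : φ (star (ρ (awayFrom x A)) * ρ (awayFrom x A)) = 0)
    (h2 : φ (star (ρ (awayFrom x Aᶜ)) * ρ (awayFrom x Aᶜ)) = 0) : False := by
  -- The two ball unions are disjoint, so the projections `p`, `q` onto their complements satisfy `p
  -- + q = 1 + p q`. Applying `φ` gives `0 = 1 + φ(v* v)`, against positivity.
  set v := awayFrom x A * awayFrom x Aᶜ
  have key : star (awayFrom x A) * awayFrom x A + star (awayFrom x Aᶜ) * awayFrom x Aᶜ =
      1 + star v * v := by
    ext y
    change star (awayFrom x A y) * awayFrom x A y + star (awayFrom x Aᶜ y) * awayFrom x Aᶜ y =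
      1 + star (awayFrom x A y * awayFrom x Aᶜ y) * (awayFrom x A y * awayFrom x Aᶜ y)
    have hdis := Set.disjoint_left.1 (disjoint_ballUnion hx (disjoint_compl_right (a := A)))
    by_cases hy : y ∈ ballUnion x A
    · have e1 : awayFrom x A y = 0 := indic_apply_of_notMem (by simpa using hy)
      have e2 : awayFrom x Aᶜ y = 1 := indic_apply_of_mem (hdis hy)
      simp [e1, e2]
    · have e1 : awayFrom x A y = 1 := indic_apply_of_mem hy
      simp [e1]
  have h3 : φ _ = φ _ := congrArg φ (congrArg ρ key)
  rw [map_add ρ, map_mul ρ, map_mul ρ, map_star ρ, map_star ρ, map_add φ, h1, h2, map_add ρ,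
    _root_.map_one ρ, map_add φ, hφ.map_one, map_mul ρ, map_star ρ] at h3
  have h4 := hφ.re_nonneg (ρ v)
  have h5 := congrArg Complex.re h3
  simp only [add_zero, Complex.zero_re, Complex.add_re, Complex.one_re] at h5
  linarith

end Bump

/-- An independent family of `2^ℵ₀` subsets of `ℕ`. -/
theorem exists_independent_family : ∃ I : Set ℕ → Set ℕ, ∀ (s : Set (Set ℕ)) (J : Finset (Set ℕ)),
    {n | ∀ i ∈ J, n ∈ I i ↔ i ∈ s}.Infinite := by
  classical
  obtain ⟨_⟩ := nonempty_denumerable (ℕ × Finset ℕ × Finset (Finset ℕ))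
  set e := Denumerable.eqv (ℕ × Finset ℕ × Finset (Finset ℕ))
  -- Hausdorff's construction: an integer codes `(k, F, T)` and belongs to `I i` when the trace of
  -- `i` on `F` is in `T`. The idle coordinate `k` makes the solution sets infinite.
  refine ⟨fun i => {n | (e.symm n).2.1.filter (· ∈ i) ∈ (e.symm n).2.2}, fun s J => ?_⟩
  have hsep : ∀ i j : Set ℕ, ∃ n, i ≠ j → ¬ (n ∈ i ↔ n ∈ j) := by
    intro i j
    by_cases hij : i = j
    · exact ⟨0, fun h => absurd hij h⟩
    · by_contra! hcon
      exact hij (Set.ext fun n => (hcon n).2)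
  choose d hd using hsep
  -- `F` is large enough that distinct members of `J` have distinct traces on it; `T` collects the
  -- traces of those members that belong to `s`.
  set F := (J ×ˢ J).image fun p => d p.1 p.2
  set T := (J.filter (· ∈ s)).image fun i => F.filter (· ∈ i) with hT
  have hinj : Function.Injective fun k : ℕ => e (k, F, T) := fun k l hkl => by
    simpa using hkl
  refine (Set.infinite_range_of_injective hinj).mono ?_
  rintro _ ⟨k, rfl⟩ i hi
  simp only [Set.mem_ofPred_eq, Equiv.symm_apply_apply, hT, Finset.mem_image, Finset.mem_filter]
  constructor
  · rintro ⟨j, ⟨hj, hjs⟩, hji⟩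
    by_contra his
    have hne : j ≠ i := fun h => his (h ▸ hjs)
    have hmem : d j i ∈ F := Finset.mem_image.2 ⟨(j, i), Finset.mk_mem_product hj hi, rfl⟩
    have := congrArg (d j i ∈ ·) hji
    simp only [Finset.mem_filter, hmem, true_and, eq_iff_iff] at this
    exact hd j i hne this
  · exact fun his => ⟨i, ⟨hi, his⟩, rfl⟩

open scoped Classical in
/-- `A` if `p` holds and its complement otherwise. -/
def signed (p : Prop) (A : Set ℕ) : Set ℕ := if p then A else Aᶜ

/-! ### Passage to the corona, and cardinality bounds. -/

section Corona

variable {X : Type*} [MetricSpace X]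

/-- The quotient map onto the corona as a continuous linear map. -/
def toCoronaL : RoeAlgebra X →L[ℂ] RoeCorona X :=
  LinearMap.mkContinuous (toCorona X).toAlgHom.toLinearMap 1 fun a => by
    rw [one_mul]
    exact Submodule.Quotient.norm_mk_le (compactIdeal X) a

theorem toCoronaL_apply (a : RoeAlgebra X) : toCoronaL a = toCorona X a := rfl

theorem IsState.comp_toCoronaL {φ : RoeCorona X →L[ℂ] ℂ} (hφ : IsState φ) :
    IsState (φ.comp toCoronaL) where
  map_one := by simp [toCoronaL_apply, hφ.map_one]
  nonneg a := by simpa [toCoronaL_apply, map_star] using hφ.nonneg (toCorona X a)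

/-- The C⋆-algebraic bound is applied upstairs, to a lift of `q` of almost the same norm, which
avoids any use of the C⋆-identity in the quotient. -/
theorem IsState.norm_apply_le_corona {φ : RoeCorona X →L[ℂ] ℂ} (hφ : IsState φ)
    (q : RoeCorona X) : ‖φ q‖ ≤ ‖q‖ := by
  refine le_of_forall_pos_le_add fun ε hε => ?_
  obtain ⟨a, rfl, ha⟩ := Submodule.Quotient.norm_mk_lt (S := compactIdeal X) q hε
  exact (hφ.comp_toCoronaL.norm_apply_le a).trans ha.le

theorem comp_toCoronaL_mem_kmsStates {h : X → ℝ} {β : ℝ} {φ : RoeCorona X →L[ℂ] ℂ}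
    (hφ : φ ∈ kmsStates (coronaFlow h) β) : φ.comp toCoronaL ∈ kmsStates (roeFlow h) β :=
  comp_mem_kmsStates (toCorona X) toCoronaL toCoronaL_apply (coronaFlow_toCorona h) hφ

/-- The space is a countable union of finite balls, and an operator is determined by its countably
many matrix entries. -/
theorem mk_roeAlgebra_le (hX : UniformlyLocallyFinite X) :
    Cardinal.mk (RoeAlgebra X) ≤ Cardinal.continuum := by
  have hcount : Cardinal.mk X ≤ Cardinal.aleph0 := by
    rw [Cardinal.mk_le_aleph0_iff]
    cases isEmpty_or_nonempty X with
    | inl _ => infer_instance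
    | inr hne =>
      obtain ⟨x₀⟩ := hne
      rw [← Set.countable_univ_iff, ← Metric.iUnion_closedBall_nat x₀]
      exact Set.countable_iUnion fun n => (hX.finite_closedBall x₀ n).countable
  have hinj : Function.Injective fun (a : RoeAlgebra X) (p : X × X) => entry (toOp a) p.1 p.2 := by
    classical
    intro a b hab
    refine Subtype.ext (ContinuousLinearMap.ext fun ξ => ?_)
    change toOp a ξ = toOp b ξ
    have hsub : ∀ x y, entry (toOp a - toOp b) x y = 0 := fun x y =>
      sub_eq_zero.2 (congrFun hab (x, y))
    rw [← sub_eq_zero, ← sub_apply]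
    ext x
    rw [apply_eq_sum_entry _ ξ x ∅ fun y _ => hsub x y]
    simp
  refine (Cardinal.mk_le_of_injective hinj).trans ?_
  have hmul : Cardinal.mk (X × X) ≤ Cardinal.aleph0 := by
    rw [Cardinal.mk_prod, Cardinal.lift_id]
    exact (mul_le_mul' hcount hcount).trans_eq Cardinal.aleph0_mul_aleph0
  rw [Cardinal.mk_arrow, Cardinal.mk_complex, Cardinal.lift_continuum, Cardinal.lift_uzero]
  exact (Cardinal.power_le_power_left Cardinal.continuum_ne_zero hmul).trans_eq
    Cardinal.continuum_power_aleph0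

theorem mk_functionals_le (hX : UniformlyLocallyFinite X) :
    Cardinal.mk (RoeAlgebra X →L[ℂ] ℂ) ≤
      (2 : Cardinal) ^ ((2 : Cardinal) ^ Cardinal.aleph0) := by
  refine (Cardinal.mk_le_of_injective (DFunLike.coe_injective (F := RoeAlgebra X →L[ℂ] ℂ))).trans ?_
  rw [Cardinal.mk_arrow, Cardinal.mk_complex, Cardinal.lift_continuum, Cardinal.lift_uzero,
    Cardinal.two_power_aleph0]
  refine (Cardinal.power_le_power_left Cardinal.continuum_ne_zero (mk_roeAlgebra_le hX)).trans_eq ?_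
  rw [← Cardinal.two_power_aleph0, ← Cardinal.power_mul, Cardinal.two_power_aleph0,
    Cardinal.aleph0_mul_continuum]

theorem mk_corona_functionals_le (hX : UniformlyLocallyFinite X) :
    Cardinal.mk (RoeCorona X →L[ℂ] ℂ) ≤
      (2 : Cardinal) ^ ((2 : Cardinal) ^ Cardinal.aleph0) := by
  refine (Cardinal.mk_le_of_injective (f := fun φ : RoeCorona X →L[ℂ] ℂ => φ.comp toCoronaL)
    fun φ ψ hφψ => ?_).trans (mk_functionals_le hX)
  ext q
  obtain ⟨a, rfl⟩ := toCorona_surjective q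
  exact DFunLike.congr_fun hφψ a

/-- A set of states that contains, for each choice of signs on the independent family, a state
supported near the corresponding points, has cardinality at least `2^(2^ℵ₀)`. -/
theorem two_power_le_mk_of_supported {x : ℕ → X}
    (hx : ∀ m n : ℕ, m < n → 2 * ((n : ℝ) + 1) < dist (x m) (x n)) {A' : Type*} [NormedRing A']
    [NormedAlgebra ℂ A'] [StarRing A'] (ρ : ℓ^∞(X, ℂ) →⋆ₐ[ℂ] A') (I : Set ℕ → Set ℕ)
    {E : Set (A' →L[ℂ] ℂ)} (hE : ∀ φ ∈ E, IsState φ)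
    (hsupp : ∀ s : Set (Set ℕ), ∃ φ ∈ E, ∀ i,
      φ (star (ρ (awayFrom x (signed (i ∈ s) (I i)))) * ρ (awayFrom x (signed (i ∈ s) (I i)))) = 0) :
    (2 : Cardinal) ^ ((2 : Cardinal) ^ Cardinal.aleph0) ≤ Cardinal.mk E := by
  choose Φ hΦE hΦ using hsupp
  have hinj : Function.Injective fun s => (⟨Φ s, hΦE s⟩ : E) := by
    intro s t hst
    have hst' : Φ s = Φ t := congrArg Subtype.val hst
    -- An index in `s` but not in `t` would put one state both on the balls over `I i` and on those
    -- over its complement.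
    have key : ∀ (s t : Set (Set ℕ)), Φ s = Φ t → s ⊆ t := fun s t hst i his => by
      by_contra hit
      have h1 := hΦ s i
      have h2 := hΦ t i
      rw [← hst] at h2
      rw [signed, if_pos his] at h1
      rw [signed, if_neg hit] at h2
      exact (hE _ (hΦE s)).not_supported_compl hx ρ h1 h2
    exact (key s t hst').antisymm (key t s hst'.symm)
  have := Cardinal.lift_mk_le_lift_mk_of_injective hinj
  simpa [Cardinal.mk_set] using this

end Corona

end UniformRoe

end

/-! ### The main theorem. -/

open UniformRoe in
theorem corollary4p13 {X : Type*} [MetricSpace X] [Infinite X]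
    (hX : UniformRoe.UniformlyLocallyFinite X) (h : X → ℝ) (hh : UniformRoe.IsCoarseMap h) (β : ℝ)
    (S : Set (UniformRoe.RoeCorona X →L[ℂ] ℂ))
    (hS : S ⊆ UniformRoe.kmsStates (UniformRoe.coronaFlow h) β)
    (hfaithful : UniformRoe.JointlyFaithfulOn S (UniformRoe.higsonCoronaAlgebra X)) :
    Cardinal.mk ((UniformRoe.kmsStates (UniformRoe.coronaFlow h) β).extremePoints ℝ) =
        (2 : Cardinal) ^ ((2 : Cardinal) ^ Cardinal.aleph0) ∧
      Cardinal.mk {φ : UniformRoe.RoeAlgebra X →L[ℂ] ℂ |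
          φ ∈ (UniformRoe.kmsStates (UniformRoe.roeFlow h) β).extremePoints ℝ ∧
          ∀ a : UniformRoe.RoeAlgebra X, IsCompactOperator (UniformRoe.toOp a) → φ a = 0} =
        (2 : Cardinal) ^ ((2 : Cardinal) ^ Cardinal.aleph0) := by
  classical
  obtain ⟨x, hx⟩ := exists_sparse_seq hX
  have hxinj : Function.Injective x := Function.Injective.of_lt_imp_ne fun m n hmn heq => by
    have h1 := hx m n hmn
    rw [heq, dist_self] at h1
    have : (0 : ℝ) ≤ n := n.cast_nonneg
    linarith
  obtain ⟨I, hI⟩ := exists_independent_family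
  have hfin : ∀ (s : Set (Set ℕ)) (J : Finset (Set ℕ)), ∃ φ ∈ kmsStates (coronaFlow h) β,
      ∀ i ∈ J, φ (star (diagCorona (awayFrom x (signed (i ∈ s) (I i)))) *
        diagCorona (awayFrom x (signed (i ∈ s) (I i)))) = 0 := by
    intro s J
    -- The infinite set is the intersection of the signed sets over `J`, so one compressed state
    -- serves every `i` in `J`.
    obtain ⟨φ, hφ, h0⟩ := exists_kmsState_supported hX hS hfaithful hxinj (hI s J)
    refine ⟨φ, hφ, fun i hi => h0 _ fun n hn => ?_⟩
    have := hn i hi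
    by_cases his : i ∈ s
    · simpa [signed, his] using this
    · simpa [signed, his] using this
  constructor
  · refine le_antisymm ((Cardinal.mk_set_le _).trans (mk_corona_functionals_le hX))
      (two_power_le_mk_of_supported hx diagCorona I (fun φ hφ => hφ.1.1) fun s => ?_)
    obtain ⟨φ, hφ, h0⟩ := exists_extreme_kmsState (fun φ hφ => hφ.norm_apply_le_corona)
      (coronaFlow h) β (Set.range fun i => diagCorona (awayFrom x (signed (i ∈ s) (I i))))
      fun B₀ hB₀ => by
        obtain ⟨J, -, rfl⟩ := Finset.subset_set_image_iff.1 (Set.image_univ ▸ hB₀)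
        obtain ⟨φ, hφ, h0⟩ := hfin s J
        refine ⟨φ, hφ, fun b hb => ?_⟩
        obtain ⟨i, hi, rfl⟩ := Finset.mem_image.1 hb
        exact h0 i hi
    exact ⟨φ, hφ, fun i => h0 _ ⟨i, rfl⟩⟩
  · refine le_antisymm ((Cardinal.mk_set_le _).trans (mk_functionals_le hX))
      (two_power_le_mk_of_supported hx diagRoe I (fun φ hφ => hφ.1.1.1) fun s => ?_)
    set W : Set ℕ → RoeAlgebra X := fun i => diagRoe (awayFrom x (signed (i ∈ s) (I i)))
    -- Adding the compact operators to the annihilated elements gives a state that is extreme among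
    -- all KMS states of the Roe algebra; by Cauchy-Schwarz it vanishes on the compact operators.
    -- The finite subproblems are solved by pullbacks from the corona, where compact operators
    -- become zero.
    obtain ⟨φ, hφ, h0⟩ := exists_extreme_kmsState (fun φ hφ => hφ.norm_apply_le)
      (roeFlow h) β (Set.range W ∪ {a | IsCompactOperator (toOp a)}) fun B₀ hB₀ => by
        obtain ⟨J, -, hJ⟩ := Finset.subset_set_image_iff.1
          (show ((B₀.filter (· ∈ Set.range W) : Finset (RoeAlgebra X)) : Set (RoeAlgebra X)) ⊆
            W '' Set.univ by
            intro b hb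
            rw [Set.image_univ]
            exact (Finset.mem_filter.1 hb).2)
        obtain ⟨φ, hφ, h0⟩ := hfin s J
        refine ⟨_, comp_toCoronaL_mem_kmsStates hφ, fun b hb => ?_⟩
        rw [ContinuousLinearMap.comp_apply, toCoronaL_apply, map_mul, map_star]
        rcases hB₀ hb with hbW | hbK
        · have hb' : b ∈ J.image W := hJ ▸ Finset.mem_filter.2 ⟨hb, hbW⟩
          obtain ⟨i, hi, rfl⟩ := Finset.mem_image.1 hb'
          exact h0 i hi
        · rw [toCorona_eq_zero_iff.2 hbK, mul_zero, map_zero]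
    exact ⟨φ, ⟨hφ, fun a ha => hφ.1.1.apply_eq_zero (h0 a (Or.inr ha))⟩,
      fun i => h0 _ (Or.inl ⟨i, rfl⟩)⟩
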